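/- **Setting.** Let $(\Omega,\mathcal A,\mathbb P)$ be a probability space, $(E,\mathcal T)$ a measurable space, and $X=(X_i)_{i\ge1}$ a stationary process on $\Omega$ with values in $E$. Let $T(x_1,x_2,\dots)=(x_2,x_3,\dots)$ be the shift on $E^{\mathbb N_+}$. Let $(\mathcal Y,\|\cdot\|)$ be a separable normed vector space, and for each $n\ge1$ let $S_n\Phi:E^{\mathbb N_+}\to\mathcal Y$ be measurable (product $\sigma$-field to Borel $\sigma$-field). Let $\mu_n$ be the law of $S_n\Phi(X)/n$. Let $(k(n))_{n\ge1}$ be an increasing sequence of positive integers (not necessarily strictly), and for $\omega\in\Omega$ put $$\mu_n^\omega=\frac1{k(n)}\sum_{j=1}^{k(n)}\delta_{x_{n,j}(\omega)},\qquad x_{n,j}(\omega)=\frac{S_n\Phi(T^{(j-1)n}X(\omega))}{n}.$$ **Large deviations.** Let $I:\mathcal Y\to[0,\infty]$ be lower semicontinuous, and let $\mathcal D_I=\{x:I(x)<\infty\}$. For a sequence $(\nu_n)_{n\ge1}$ of probability measures on $\mathcal Y$ and $\Gamma\subset\mathcal Y$ consider the two bounds (with $\log 0=-\infty$, $\inf\emptyset=+\infty$)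 $$\text{(L)}\ -\inf_{\mathring\Gamma}I\le\liminf_{n\to\infty}\frac1n\log\nu_n(\Gamma),\qquad \text{(U)}\ \limsup_{n\to\infty}\frac1n\log\nu_n(\Gamma)\le-\inf_{\overline\Gamma}I .$$ The sequence $(\nu_n)$ satisfies the LDP with rate function $I$ if (L) and (U) hold for every $\Gamma$ in the completed Borel $\sigma$-field (the sets measurable for the completion of every $\nu_n$). It satisfies the weak LDP with rate function $I$ if (L) holds for all such $\Gamma$ and (U) holds for all compact $\Gamma$. The rate function $I$ is good if $\{I\le a\}$ is compact for every $a\in[0,\infty)$. The sequence $(\nu_n)$ is exponentially tight if for every $a<\infty$ there is a compact $K$ with $\limsup_{n\to\infty}\frac1n\log\nu_n(K^c)\le-a$. **Mixing.** For sub-$\sigma$-fields $\mathcal U,\mathcal V$ of $\mathcal A$ let $\alpha(\mathcal U,\mathcal V)=\sup\{|\mathbb P(U)\mathbb P(V)-\mathbb P(U\cap V)|:U\in\mathcal U,V\in\mathcal V\}$. Put $\alpha_{X,0}=1/2$ and, for $m\ge1$, $\alpha_{X,m}=\sup_{i\ge1}\alpha\big(\sigma(X_k:k\le i),\sigma(X_j:j\ge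 i+m)\big)$. For $u\in[0,1]$ let $\alpha_X^{-1}(u)=\inf\{m\ge0:\alpha_{X,m}\le u\}\in[0,\infty]$. **Assumptions.** * (A1) $(\mu_n)_{n\ge1}$ satisfies the LDP with rate function $I$. * (A2) $\int_0^1(\alpha_X^{-1}(u))^h\,du<\infty$ for every $h>0$. * (A3) There are functions $S_n\Phi_n:E^{\mathbb N_+}\to\mathcal Y$, each depending only on the first $2n$ coordinates, such that $\sup_{z\in E^{\mathbb N_+}}\|S_n\Phi(z)-S_n\Phi_n(z)\|/n\to0$ as $n\to\infty$. **Theorem 2.2.** Assume (A1), (A2) and (A3). Suppose that either $\sup_{x\in\mathcal D_I}I(x)<\infty$ and $\liminf_{n\to\infty}\frac{\log k(n)}n>\sup_{x\in\mathcal D_I}I(x)$, or $\lim_{n\to\infty}\frac{\log k(n)}n=\infty$. Then for $\mathbb P$-almost every $\omega$ the sequence $(\mu_n^\omega)_{n\ge1}$ satisfies the weak LDP with rate function $I$. If, moreover, $(\mu_n)_{n\ge1}$ is exponentially tight, then $I$ is good and for $\mathbb P$-almost every $\omega$ the sequence $(\mu_n^\omega)_{n\ge1}$ satisfies the LDP with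 rate function $I$. -/

import Mathlib

open MeasureTheory Filter Topology
open scoped ENNReal

namespace LocalLDP

noncomputable section

/-! ### Large deviation principles

Sequences indexed by `n ≥ 1` are functions on `ℕ` whose value at `0` plays no role. -/

section LDP

variable {Y : Type*} [TopologicalSpace Y] [MeasurableSpace Y]

/-- `(1/n) log μ_n(Γ)` as an extended real number, with `log 0 = -∞`. -/
def logRate (μ : ℕ → Measure Y) (Γ : Set Y) (n : ℕ) : EReal :=
  ENNReal.log (μ n Γ) / (n : EReal)

/-- The completed Borel field: the sets that are measurable for the completion of every `μ_n`,
`n ≥ 1`. Every Borel set belongs to it. -/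
def InCompletedBorel (μ : ℕ → Measure Y) (Γ : Set Y) : Prop :=
  ∀ n, 1 ≤ n → NullMeasurableSet Γ (μ n)

/-- The large deviation lower bound `-inf_{int Γ} I ≤ liminf (1/n) log μ_n(Γ)`. -/
def LowerBound (μ : ℕ → Measure Y) (I : Y → ℝ≥0∞) (Γ : Set Y) : Prop :=
  -((⨅ x ∈ interior Γ, I x : ℝ≥0∞) : EReal) ≤ liminf (logRate μ Γ) atTop

/-- The large deviation upper bound `limsup (1/n) log μ_n(Γ) ≤ -inf_{cl Γ} I`. -/
def UpperBound (μ : ℕ → Measure Y) (I : Y → ℝ≥0∞) (Γ : Set Y) : Prop :=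
  limsup (logRate μ Γ) atTop ≤ -((⨅ x ∈ closure Γ, I x : ℝ≥0∞) : EReal)

/-- `(μ_n)` satisfies the LDP with rate function `I : Y → [0,∞]`. -/
structure SatisfiesLDP (μ : ℕ → Measure Y) (I : Y → ℝ≥0∞) : Prop where
  lsc : LowerSemicontinuous I
  lower : ∀ Γ, InCompletedBorel μ Γ → LowerBound μ I Γ
  upper : ∀ Γ, InCompletedBorel μ Γ → UpperBound μ I Γ

/-- `(μ_n)` satisfies the weak LDP with rate function `I`: the upper bound is required for compact
sets only. -/
structure SatisfiesWeakLDP (μ : ℕ → Measure Y) (I : Y → ℝ≥0∞) : Prop where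
  lsc : LowerSemicontinuous I
  lower : ∀ Γ, InCompletedBorel μ Γ → LowerBound μ I Γ
  upper : ∀ Γ, IsCompact Γ → UpperBound μ I Γ

/-- Goodness of a rate function: all level sets `{I ≤ a}`, `0 ≤ a < ∞`, are compact. -/
def IsGoodRate (I : Y → ℝ≥0∞) : Prop :=
  ∀ a : NNReal, IsCompact {x | I x ≤ (a : ℝ≥0∞)}

/-- Exponential tightness. -/
def ExponentiallyTight (μ : ℕ → Measure Y) : Prop :=
  ∀ a : ℝ, ∃ K : Set Y, IsCompact K ∧ limsup (logRate μ Kᶜ) atTop ≤ ((-a : ℝ) : EReal)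

end LDP

/-- The domain `{I < ∞}` of `I`. -/
def rateDomain {Y : Type*} (I : Y → ℝ≥0∞) : Set Y := {x | I x < ⊤}

/-! ### Stationary processes and mixing

The process `(X_i)_{i ≥ 1}` is `X : ℕ → Ω → E`, where `X i` stands for `X_{i+1}`. -/

section Mixing

variable {Ω E : Type*} [MeasurableSpace Ω] [MeasurableSpace E]

/-- The `m`-th iterate of the shift on sequences. -/
def shift (m : ℕ) (z : ℕ → E) : ℕ → E := fun i => z (i + m)

/-- The trajectory `X(ω)`. -/
def path (X : ℕ → Ω → E) (ω : Ω) : ℕ → E := fun i => X i ω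

/-- `X` is a (measurable) stationary process: the law of the shifted process on the product space
is that of `X`. -/
structure IsStationary (P : Measure Ω) (X : ℕ → Ω → E) : Prop where
  measurable : ∀ i, Measurable (X i)
  map_shift : ∀ m, P.map (fun ω => shift m (path X ω)) = P.map (path X)

/-- The α-mixing coefficient `sup |P(U) P(V) - P(U ∩ V)|` of two σ-algebras. -/
def alphaCoeff (P : Measure Ω) (𝒰 𝒱 : MeasurableSpace Ω) : ℝ≥0∞ :=
  ⨆ (U : Set Ω) (V : Set Ω) (_ : MeasurableSet[𝒰] U) (_ : MeasurableSet[𝒱] V),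
    ENNReal.ofReal |P.real U * P.real V - P.real (U ∩ V)|

/-- `σ(X_k : k ≤ i)`. -/
abbrev sigmaPast (X : ℕ → Ω → E) (i : ℕ) : MeasurableSpace Ω :=
  ⨆ (k : ℕ) (_ : k ≤ i), MeasurableSpace.comap (X k) inferInstance

/-- `σ(X_j : j ≥ i)`. -/
abbrev sigmaFuture (X : ℕ → Ω → E) (i : ℕ) : MeasurableSpace Ω :=
  ⨆ (j : ℕ) (_ : i ≤ j), MeasurableSpace.comap (X j) inferInstance

/-- The Rosenblatt mixing coefficients `α_{X,m}`, with `α_{X,0} = 1/2`. -/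
def alphaMixing (P : Measure Ω) (X : ℕ → Ω → E) (m : ℕ) : ℝ≥0∞ :=
  if m = 0 then 1 / 2 else ⨆ i : ℕ, alphaCoeff P (sigmaPast X i) (sigmaFuture X (i + m))

/-- `α_X⁻¹(u) = inf {m : α_{X,m} ≤ u}`, equal to `∞` if there is no such `m`. -/
def alphaInv (P : Measure Ω) (X : ℕ → Ω → E) (u : ℝ) : ℝ≥0∞ :=
  ⨅ (m : ℕ) (_ : alphaMixing P X m ≤ ENNReal.ofReal u), (m : ℝ≥0∞)

/-- `M_h = ∫₀¹ (α_X⁻¹(u))^h du`, a number in `[0,∞]`. -/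
def mixingMoment (P : Measure Ω) (X : ℕ → Ω → E) (h : ℝ) : ℝ≥0∞ :=
  ∫⁻ u in Set.Icc (0 : ℝ) 1, alphaInv P X u ^ h

/-! ### Laws and local empirical measures

`S n : (ℕ → E) → Y` is the function written `S_n Φ`. -/

variable {Y : Type*} [NormedAddCommGroup Y] [NormedSpace ℝ Y]

/-- `S_n Φ` is, up to a uniform error `o(n)`, a function of the first `2n` coordinates. -/
def UniformlyApproximable (S : ℕ → (ℕ → E) → Y) : Prop :=
  ∃ R : ℕ → (ℕ → E) → Y, (∀ n, DependsOn (R n) (Set.Iio (2 * n))) ∧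
    Tendsto (fun n : ℕ => ⨆ z : ℕ → E, ‖S n z - R n z‖ₑ / (n : ℝ≥0∞)) atTop (𝓝 0)

variable [MeasurableSpace Y]

/-- `μ_n`, the law of `S_n Φ(X) / n`. -/
def law (P : Measure Ω) (X : ℕ → Ω → E) (S : ℕ → (ℕ → E) → Y) (n : ℕ) : Measure Y :=
  P.map (fun ω => (n : ℝ)⁻¹ • S n (path X ω))

/-- `μ_n^ω = (1/k(n)) ∑_{1 ≤ j ≤ k(n)} δ_{S_n Φ(T^{(j-1)n} X(ω)) / n}`. -/
def empirical (k : ℕ → ℕ) (X : ℕ → Ω → E) (S : ℕ → (ℕ → E) → Y) (ω : Ω) (n : ℕ) : Measure Y :=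
  (k n : ℝ≥0∞)⁻¹ • ∑ j ∈ Finset.Icc 1 (k n),
    Measure.dirac ((n : ℝ)⁻¹ • S n (shift ((j - 1) * n) (path X ω)))

end Mixing

end

end LocalLDP

/-! By stationarity the random measure `μ_n^ω` has mean `μ_n`, so the question is how far it strays
from its mean on the exponential scale. Excess is controlled by a first moment: Markov's inequality
and Borel–Cantelli carry an exponential upper bound on `μ_n(A)` over to `μ_n^ω(A)`, almost surely
and with an arbitrarily small loss of rate (`ae_expLE_empirical`).

Deficit is controlled by a second moment, which needs many nearly independent trials. Uniform
approximation makes each trial a function of `2n` coordinates. Success has probability `q ≥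
e^{-a'n}`, so covariances must be small against `q²`, whereas mixing is only known to be faster than
every power. Hence only blocks `L ≈ e^{δn}` apart are kept: `L^{-h}` with `h` large beats `q²`, and
the number of trials drops only by a factor of order `e^{δn}`. Since `k(n)` grows at a rate above
`a'`, exponentially many successes are still expected, and by Chebyshev and Borel–Cantelli at least
half of them occur (`measureReal_card_le_half`, `ae_expGE_empirical`).

These almost sure statements concern one set and fixed rates. A countable basis and rational
parameters give a single null set; lower bounds then follow near each interior point, and upper
bounds by finite covers of compact sets (`expLE_of_isCompact`). Exponential tightness passes to
`μ_n^ω` along a sequence of compact sets and upgrades the weak LDP to the full one. -/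

namespace LocalLDP

/-! ### Exponential bounds on sequences of measures -/

section Rates

variable {Y : Type*} [MeasurableSpace Y]

/-- Eventually `μ_n(Γ) ≤ e^{-bn}`. -/
def ExpLE (μ : ℕ → Measure Y) (Γ : Set Y) (b : ℝ) : Prop :=
  ∀ᶠ n : ℕ in atTop, μ n Γ ≤ ENNReal.ofReal (Real.exp (-b * n))

/-- Eventually `e^{-bn} ≤ μ_n(Γ)`. -/
def ExpGE (μ : ℕ → Measure Y) (Γ : Set Y) (b : ℝ) : Prop :=
  ∀ᶠ n : ℕ in atTop, ENNReal.ofReal (Real.exp (-b * n)) ≤ μ n Γ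

theorem log_ofReal_exp (x : ℝ) : ENNReal.log (ENNReal.ofReal (Real.exp x)) = x := by
  rw [ENNReal.log_ofReal_of_pos (Real.exp_pos x), Real.log_exp]

theorem logRate_le_iff {μ : ℕ → Measure Y} {Γ : Set Y} {n : ℕ} (hn : 1 ≤ n) (c : ℝ) :
    logRate μ Γ n ≤ c ↔ μ n Γ ≤ ENNReal.ofReal (Real.exp (c * n)) := by
  have h0 : (0 : EReal) < (n : EReal) := by exact_mod_cast hn
  rw [logRate, EReal.div_le_iff_le_mul h0 (EReal.natCast_ne_top n),
    ← ENNReal.log_le_log_iff, log_ofReal_exp, EReal.coe_mul, mul_comm]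
  rfl

theorem le_logRate_iff {μ : ℕ → Measure Y} {Γ : Set Y} {n : ℕ} (hn : 1 ≤ n) (c : ℝ) :
    c ≤ logRate μ Γ n ↔ ENNReal.ofReal (Real.exp (c * n)) ≤ μ n Γ := by
  have h0 : (0 : EReal) < (n : EReal) := by exact_mod_cast hn
  rw [logRate, EReal.le_div_iff_mul_le h0 (EReal.natCast_ne_top n),
    ← ENNReal.log_le_log_iff, log_ofReal_exp, EReal.coe_mul]
  rfl

theorem expLE_of_limsup_lt {μ : ℕ → Measure Y} {Γ : Set Y} {b : ℝ}
    (h : limsup (logRate μ Γ) atTop < ((-b : ℝ) : EReal)) : ExpLE μ Γ b := by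
  filter_upwards [eventually_lt_of_limsup_lt h, eventually_ge_atTop 1] with n hn h1
  exact (logRate_le_iff h1 _).1 hn.le

theorem ExpLE.limsup_le {μ : ℕ → Measure Y} {Γ : Set Y} {b : ℝ} (h : ExpLE μ Γ b) :
    limsup (logRate μ Γ) atTop ≤ ((-b : ℝ) : EReal) := by
  refine limsup_le_of_le (by isBoundedDefault) ?_
  filter_upwards [h, eventually_ge_atTop 1] with n hn h1
  exact (logRate_le_iff h1 _).2 hn

theorem expGE_of_lt_liminf {μ : ℕ → Measure Y} {Γ : Set Y} {b : ℝ}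
    (h : ((-b : ℝ) : EReal) < liminf (logRate μ Γ) atTop) : ExpGE μ Γ b := by
  filter_upwards [eventually_lt_of_lt_liminf h, eventually_ge_atTop 1] with n hn h1
  exact (le_logRate_iff h1 _).1 hn.le

theorem ExpGE.le_liminf {μ : ℕ → Measure Y} {Γ : Set Y} {b : ℝ} (h : ExpGE μ Γ b) :
    ((-b : ℝ) : EReal) ≤ liminf (logRate μ Γ) atTop := by
  refine le_liminf_of_le (by isBoundedDefault) ?_
  filter_upwards [h, eventually_ge_atTop 1] with n hn h1
  exact (le_logRate_iff h1 _).2 hn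

theorem coe_lt_coe_ennreal {b : ℝ} (hb : 0 ≤ b) {x : ℝ≥0∞} :
    (b : EReal) < (x : EReal) ↔ ENNReal.ofReal b < x := by
  rw [← EReal.coe_ennreal_lt_coe_ennreal_iff, EReal.coe_ennreal_ofReal, max_eq_left hb]

theorem coe_ennreal_lt_coe {b : ℝ} (hb : 0 ≤ b) {x : ℝ≥0∞} :
    (x : EReal) < (b : EReal) ↔ x < ENNReal.ofReal b := by
  rw [← EReal.coe_ennreal_lt_coe_ennreal_iff, EReal.coe_ennreal_ofReal, max_eq_left hb]

theorem ExpLE.mono {μ : ℕ → Measure Y} {Γ Γ' : Set Y} {b b' : ℝ} (h : ExpLE μ Γ b)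
    (hΓ : Γ' ⊆ Γ) (hb : b' ≤ b) : ExpLE μ Γ' b' := by
  filter_upwards [h] with n hn
  refine (measure_mono hΓ).trans (hn.trans (ENNReal.ofReal_le_ofReal (Real.exp_le_exp.2 ?_)))
  exact mul_le_mul_of_nonneg_right (neg_le_neg hb) (Nat.cast_nonneg n)

theorem ExpGE.mono {μ : ℕ → Measure Y} {Γ Γ' : Set Y} {b b' : ℝ} (h : ExpGE μ Γ b)
    (hΓ : Γ ⊆ Γ') (hb : b ≤ b') : ExpGE μ Γ' b' := by
  filter_upwards [h] with n hn
  refine le_trans (ENNReal.ofReal_le_ofReal (Real.exp_le_exp.2 ?_)) (hn.trans (measure_mono hΓ))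
  exact mul_le_mul_of_nonneg_right (neg_le_neg hb) (Nat.cast_nonneg n)

theorem tendsto_exp_mul_nat_atTop {δ : ℝ} (hδ : 0 < δ) :
    Tendsto (fun n : ℕ => Real.exp (δ * n)) atTop atTop :=
  Real.tendsto_exp_atTop.comp (tendsto_natCast_atTop_atTop.const_mul_atTop hδ)

/-- The factor `2` from adding the two bounds is absorbed by `e^{(b-b')n}`, whence the strict loss
of rate. -/
theorem ExpLE.union {μ : ℕ → Measure Y} {Γ Γ' : Set Y} {b b' : ℝ} (h : ExpLE μ Γ b)
    (h' : ExpLE μ Γ' b) (hb : b' < b) : ExpLE μ (Γ ∪ Γ') b' := by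
  filter_upwards [h, h', (tendsto_exp_mul_nat_atTop (sub_pos.2 hb)).eventually_ge_atTop 2]
    with n hn hn' h2
  refine (measure_union_le _ _).trans ((add_le_add hn hn').trans ?_)
  rw [← ENNReal.ofReal_add (Real.exp_nonneg _) (Real.exp_nonneg _)]
  refine ENNReal.ofReal_le_ofReal ?_
  have e : Real.exp (-b' * n) = Real.exp ((b - b') * n) * Real.exp (-b * n) := by
    rw [← Real.exp_add]; ring_nf
  rw [e]
  nlinarith [Real.exp_pos (-b * n)]

variable [TopologicalSpace Y]

theorem UpperBound.expLE {μ : ℕ → Measure Y} {I : Y → ℝ≥0∞} {Γ : Set Y} (h : UpperBound μ I Γ)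
    {b : ℝ} (hb0 : 0 ≤ b) (hb : ENNReal.ofReal b < ⨅ x ∈ closure Γ, I x) : ExpLE μ Γ b := by
  refine expLE_of_limsup_lt (h.trans_lt ?_)
  rw [EReal.coe_neg, EReal.neg_lt_neg_iff]
  exact (coe_lt_coe_ennreal hb0).2 hb

theorem upperBound_of_expLE {μ : ℕ → Measure Y} {I : Y → ℝ≥0∞} {Γ : Set Y}
    (h1 : ∀ n, 1 ≤ n → μ n Γ ≤ 1)
    (h : ∀ b : ℝ, 0 ≤ b → ENNReal.ofReal b < ⨅ x ∈ closure Γ, I x → ExpLE μ Γ b) :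
    UpperBound μ I Γ := by
  rw [UpperBound, EReal.le_neg]
  refine EReal.ge_of_forall_gt_iff_ge.1 fun b hb => ?_
  have key : ExpLE μ Γ b := by
    -- Negative rates hold trivially, since the masses are at most `1`.
    rcases le_or_gt 0 b with hb0 | hb0
    · exact h b hb0 ((coe_lt_coe_ennreal hb0).1 hb)
    · filter_upwards [eventually_ge_atTop 1] with n hn
      refine (h1 n hn).trans ?_
      rw [← ENNReal.ofReal_one]
      refine ENNReal.ofReal_le_ofReal (Real.one_le_exp ?_)
      exact mul_nonneg (by linarith) (Nat.cast_nonneg n)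
  exact EReal.le_neg_of_le_neg key.limsup_le

theorem LowerBound.expGE {μ : ℕ → Measure Y} {I : Y → ℝ≥0∞} {Γ : Set Y} (h : LowerBound μ I Γ)
    {x : Y} (hx : x ∈ interior Γ) {b : ℝ} (hb0 : 0 ≤ b) (hb : I x < ENNReal.ofReal b) :
    ExpGE μ Γ b := by
  refine expGE_of_lt_liminf (lt_of_lt_of_le ?_ h)
  rw [EReal.coe_neg, EReal.neg_lt_neg_iff]
  exact (coe_ennreal_lt_coe hb0).2 ((iInf₂_le x hx).trans_lt hb)

/-- An infimum over the interior is approached at single points, so the lower bound can be checked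
locally, at points of finite rate. -/
theorem lowerBound_of_expGE {μ : ℕ → Measure Y} {I : Y → ℝ≥0∞} {Γ : Set Y}
    (h : ∀ x ∈ interior Γ, ∀ b : ℝ, 0 ≤ b → I x < ENNReal.ofReal b → ExpGE μ Γ b) :
    LowerBound μ I Γ := by
  rw [LowerBound, EReal.neg_le]
  refine EReal.le_of_forall_lt_iff_le.1 fun b hb => ?_
  have hb0 : 0 ≤ b := by exact_mod_cast (EReal.coe_ennreal_nonneg _).trans hb.le
  obtain ⟨x, hx, hxb⟩ : ∃ x, ∃ _ : x ∈ interior Γ, I x < ENNReal.ofReal b := by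
    simpa only [iInf_lt_iff] using (coe_ennreal_lt_coe hb0).1 hb
  exact EReal.neg_le_of_neg_le (h x hx b hb0 hxb).le_liminf

/-- A point with `I x ≤ a` outside a compact `K` whose complement decays at rate `a + 1` would
contradict the lower bound on the open set `Kᶜ`. So level sets are closed subsets of compact sets.
-/
theorem ExponentiallyTight.isGoodRate [T2Space Y] [OpensMeasurableSpace Y] {μ : ℕ → Measure Y}
    {I : Y → ℝ≥0∞} (hμ : SatisfiesLDP μ I) (h : ExponentiallyTight μ) : IsGoodRate I := by
  intro a
  obtain ⟨K, hK, hlim⟩ := h (a + 1)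
  refine hK.of_isClosed_subset (hμ.lsc.isClosed_preimage _) fun x hx => ?_
  by_contra hxK
  have h1 := (hμ.lower Kᶜ fun n _ => hK.isClosed.measurableSet.compl.nullMeasurableSet).trans
    ((liminf_le_limsup (by isBoundedDefault) (by isBoundedDefault)).trans hlim)
  rw [EReal.coe_neg, EReal.neg_le_neg_iff] at h1
  have h2 : (((a : ℝ) + 1 : ℝ) : EReal) ≤ ((a : ℝ) : EReal) := by
    refine h1.trans ?_
    refine (EReal.coe_ennreal_le_coe_ennreal_iff.2 ((iInf₂_le x ?_).trans hx)).trans ?_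
    · rwa [hK.isClosed.isOpen_compl.interior_eq]
    · exact le_of_eq rfl
  have h3 := EReal.coe_le_coe_iff.1 h2
  linarith

end Rates

/-- An upper bound along a countable basis extends to compact sets. -/
theorem expLE_of_isCompact {Y : Type*} [TopologicalSpace Y] [RegularSpace Y] [MeasurableSpace Y]
    {ℬ : Set (Set Y)} (hℬ : TopologicalSpace.IsTopologicalBasis ℬ)
    {ν : ℕ → Measure Y} {I : Y → ℝ≥0∞} (hI : LowerSemicontinuous I)
    (h : ∀ B ∈ ℬ, ∀ q q' : ℚ, 0 ≤ q' → q' < q → 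
      ENNReal.ofReal q < ⨅ x ∈ closure B, I x → ExpLE ν B q')
    {K : Set Y} (hK : IsCompact K) {b : ℝ} (hb0 : 0 ≤ b) (hb : ENNReal.ofReal b < ⨅ x ∈ K, I x) :
    ExpLE ν K b := by
  obtain ⟨c, hbc, hc⟩ : ∃ c : ℝ, b < c ∧ ENNReal.ofReal c < ⨅ x ∈ K, I x := by
    obtain ⟨c, h1, h2⟩ := ENNReal.lt_iff_exists_nnreal_btwn.1 hb
    refine ⟨c, ?_, by simpa using h2⟩
    exact (ENNReal.ofReal_lt_coe_iff hb0).1 h1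
  obtain ⟨q, hbq, hqc⟩ := exists_rat_btwn hbc
  obtain ⟨q', hbq', hqq'⟩ := exists_rat_btwn hbq
  -- Unions cost some rate, so the property stable under finite unions is the bound at every rate
  -- strictly below `q'`.
  suffices H : ∀ b < (q' : ℝ), ExpLE ν K b from H b hbq'
  refine hK.induction_on (p := fun s => ∀ b < (q' : ℝ), ExpLE ν s b) ?_ ?_ ?_ ?_
  · intro b _
    exact Eventually.of_forall fun n => by simp
  · intro s t hst ht b hb
    exact (ht b hb).mono hst le_rfl
  · intro s t hs ht b hb
    obtain ⟨b', h1, h2⟩ := exists_between hb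
    exact (hs b' h2).union (ht b' h2) h1
  · intro x hx
    have hlt : ENNReal.ofReal c < I x := hc.trans_le (iInf₂_le x hx)
    -- Lower semicontinuity makes `{I > c}` a neighbourhood of `x`; regularity fits the closure of a
    -- basis set inside it.
    obtain ⟨B, hB, hxB, hBs⟩ := hℬ.exists_closure_subset ((hI x) _ hlt)
    refine ⟨B, mem_nhdsWithin_of_mem_nhds (hℬ.mem_nhds hB hxB), fun b hb => ?_⟩
    refine (h B hB q q' (by exact_mod_cast hb0.trans hbq'.le) (by exact_mod_cast hqq') ?_).mono
      subset_rfl hb.le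
    have hq0 : (0 : ℝ) < q := hb0.trans_lt hbq
    refine lt_of_lt_of_le ((ENNReal.ofReal_lt_ofReal_iff (hq0.trans hqc)).2 hqc) ?_
    exact le_iInf₂ fun y hy => le_of_lt (hBs hy)

/-! ### Mixing coefficients -/

section MixingBounds


theorem abs_le_alphaCoeff {Ω : Type*} {𝒰 𝒱 : MeasurableSpace Ω} [MeasurableSpace Ω]
    {P : Measure Ω} {U V : Set Ω}
    (hU : MeasurableSet[𝒰] U) (hV : MeasurableSet[𝒱] V) :
    ENNReal.ofReal |P.real U * P.real V - P.real (U ∩ V)| ≤ alphaCoeff P 𝒰 𝒱 :=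
  le_iSup_of_le U <| le_iSup_of_le V <| le_iSup_of_le hU <| le_iSup_of_le hV le_rfl

theorem alphaCoeff_mono {Ω : Type*} {𝒰 𝒰' 𝒱 𝒱' : MeasurableSpace Ω} [MeasurableSpace Ω]
    {P : Measure Ω} (h : 𝒰 ≤ 𝒰') (h' : 𝒱 ≤ 𝒱') : alphaCoeff P 𝒰 𝒱 ≤ alphaCoeff P 𝒰' 𝒱' :=
  iSup_le fun U => iSup_le fun V => iSup_le fun hU => iSup_le fun hV =>
    abs_le_alphaCoeff (h U hU) (h' V hV)

theorem alphaCoeff_le_one {Ω : Type*} {𝒰 𝒱 : MeasurableSpace Ω} [MeasurableSpace Ω]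
    {P : Measure Ω} [IsProbabilityMeasure P] : alphaCoeff P 𝒰 𝒱 ≤ 1 := by
  refine iSup_le fun U => iSup_le fun V => iSup_le fun _ => iSup_le fun _ => ?_
  rw [← ENNReal.ofReal_one]
  refine ENNReal.ofReal_le_ofReal (abs_le.2 ⟨?_, ?_⟩)
  · have h1 := measureReal_le_one (μ := P) (s := U ∩ V)
    have h2 : 0 ≤ P.real U * P.real V := by positivity
    linarith
  · have h1 : 0 ≤ P.real (U ∩ V) := by positivity
    have h2 : P.real U * P.real V ≤ 1 :=
      mul_le_one₀ measureReal_le_one measureReal_nonneg measureReal_le_one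
    linarith

variable {Ω E : Type*} [MeasurableSpace Ω] [MeasurableSpace E] {P : Measure Ω} {X : ℕ → Ω → E}

/-- The value at `0` is a convention, not a supremum, so it is left out. -/
theorem alphaMixing_anti {m m' : ℕ} (hm : 1 ≤ m) (h : m ≤ m') :
    alphaMixing P X m' ≤ alphaMixing P X m := by
  rw [alphaMixing, alphaMixing, if_neg (by omega), if_neg (by omega)]
  refine iSup_mono fun i => alphaCoeff_mono le_rfl ?_
  exact iSup_mono fun j => iSup_mono' fun hj => ⟨by omega, le_rfl⟩

theorem alphaMixing_le_one [IsProbabilityMeasure P] (m : ℕ) : alphaMixing P X m ≤ 1 := by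
  rw [alphaMixing]
  split_ifs
  · simp
  · exact iSup_le fun i => alphaCoeff_le_one

/-- Markov's inequality for `α_X⁻¹`. -/
theorem rpow_mul_alphaMixing_le [IsProbabilityMeasure P] {h : ℝ} (hh : 0 < h) (m : ℕ) :
    (m : ℝ≥0∞) ^ h * (alphaMixing P X m / 2) ≤ mixingMoment P X h := by
  have h1 : alphaMixing P X m ≤ 1 := alphaMixing_le_one m
  have htop : alphaMixing P X m / 2 ≠ ∞ :=
    (ENNReal.div_lt_top (h1.trans_lt ENNReal.one_lt_top).ne two_ne_zero).ne
  set t : ℝ := (alphaMixing P X m / 2).toReal with ht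
  have hofReal : ENNReal.ofReal t = alphaMixing P X m / 2 := ENNReal.ofReal_toReal htop
  have hhalf : alphaMixing P X m / 2 ≤ 1 / 2 := ENNReal.div_le_div_right h1 2
  have ht1 : t ≤ 1 := by
    rw [← ENNReal.ofReal_le_one, hofReal]
    exact hhalf.trans (ENNReal.half_le_self)
  calc (m : ℝ≥0∞) ^ h * (alphaMixing P X m / 2)
      = ∫⁻ _ in Set.Ico (0 : ℝ) t, (m : ℝ≥0∞) ^ h := by
        rw [setLIntegral_const, Real.volume_Ico, sub_zero, hofReal]
    -- For `u < α_m / 2` no `m' < m` has `α_{m'} ≤ u`. The halving covers `m' = 0`: the crude bound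
    -- `α_m ≤ 1` gives `α_m / 2 ≤ 1/2 = α_0`.
    _ ≤ ∫⁻ u in Set.Ico (0 : ℝ) t, alphaInv P X u ^ h := by
        refine setLIntegral_mono' measurableSet_Ico fun u hu => ?_
        refine ENNReal.rpow_le_rpow (le_iInf₂ fun m' hm' => ?_) hh.le
        by_contra hlt
        have hlt' : m' < m := by exact_mod_cast not_le.1 hlt
        have hut : ENNReal.ofReal u < alphaMixing P X m / 2 := by
          rw [← hofReal]
          exact (ENNReal.ofReal_lt_ofReal_iff (hu.1.trans_lt hu.2)).2 hu.2
        refine absurd hm' (not_le.2 (hut.trans_le ?_))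
        rcases Nat.eq_zero_or_pos m' with rfl | hpos
        · simpa [alphaMixing] using hhalf
        · exact (ENNReal.half_le_self).trans (alphaMixing_anti hpos hlt'.le)
    _ ≤ mixingMoment P X h := by
        refine lintegral_mono_set fun u hu => ⟨hu.1, hu.2.le.trans ht1⟩

/-- A finite moment of order `h` gives polynomial decay of order `h`, with constant twice the
moment. -/
theorem exists_alphaMixing_le [IsProbabilityMeasure P] {h : ℝ} (hh : 0 < h)
    (hA : mixingMoment P X h < ⊤) :
    ∃ C : ℝ, 0 ≤ C ∧ ∀ m : ℕ, 1 ≤ m →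
      alphaMixing P X m ≤ ENNReal.ofReal (C * (m : ℝ) ^ (-h)) := by
  refine ⟨2 * (mixingMoment P X h).toReal, by positivity, fun m hm => ?_⟩
  have hm0 : (0 : ℝ) < m := by exact_mod_cast hm
  have hne : alphaMixing P X m ≠ ∞ := ((alphaMixing_le_one m).trans_lt ENNReal.one_lt_top).ne
  have key := ENNReal.toReal_mono hA.ne (rpow_mul_alphaMixing_le (P := P) (X := X) hh m)
  rw [ENNReal.toReal_mul, ENNReal.toReal_div, ← ENNReal.toReal_rpow, ENNReal.toReal_natCast,
    ENNReal.toReal_ofNat] at key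
  rw [ENNReal.le_ofReal_iff_toReal_le hne (by positivity), Real.rpow_neg hm0.le,
    ← div_eq_mul_inv, le_div_iff₀ (by positivity)]
  linarith

/-- Events depending on coordinates separated by a gap `m` are almost independent. -/
theorem abs_sub_le_of_alphaMixing_le [IsProbabilityMeasure P] {i j m : ℕ} (hm : 1 ≤ m)
    (hij : i + m ≤ j) {U V : Set Ω} (hU : MeasurableSet[sigmaPast X i] U)
    (hV : MeasurableSet[sigmaFuture X j] V) {c : ℝ} (hc0 : 0 ≤ c)
    (hc : alphaMixing P X m ≤ ENNReal.ofReal c) :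
    |P.real U * P.real V - P.real (U ∩ V)| ≤ c := by
  rw [← ENNReal.ofReal_le_ofReal_iff hc0]
  refine le_trans ?_ hc
  rw [alphaMixing, if_neg (by omega)]
  refine le_trans ?_ (le_iSup _ i)
  refine abs_le_alphaCoeff hU ?_
  have : sigmaFuture X j ≤ sigmaFuture X (i + m) :=
    iSup_mono fun l => iSup_mono' fun hl => ⟨by omega, le_rfl⟩
  exact this V hV

end MixingBounds

/-! ### A second moment bound -/

open Classical in
/-- Chebyshev's inequality for the number of occurrences among `M` almost pairwise independent
events of equal probability. -/
theorem measureReal_card_le_half {Ω : Type*} [MeasurableSpace Ω] {P : Measure Ω}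
    [IsProbabilityMeasure P] {A : ℕ → Set Ω} {M : ℕ} {q c : ℝ} (hM : 0 < M) (hq : 0 < q)
    (hc : 0 ≤ c)
    (hA : ∀ i < M, MeasurableSet (A i)) (hAq : ∀ i < M, P.real (A i) = q)
    (hcov : ∀ i < M, ∀ j < M, i < j → |P.real (A i) * P.real (A j) - P.real (A i ∩ A j)| ≤ c) :
    P.real {ω | (((Finset.range M).filter fun i => ω ∈ A i).card : ℝ) ≤ M * q / 2} ≤
      4 / (M * q) + 4 * c / q ^ 2 := by
  have hM0 : (0 : ℝ) < M := by exact_mod_cast hM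
  set f : ℕ → Ω → ℝ := fun i => (A i).indicator 1 with hf
  have hcard : ∀ ω, (((Finset.range M).filter fun i => ω ∈ A i).card : ℝ) =
      ∑ i ∈ Finset.range M, f i ω := by
    intro ω
    rw [Finset.card_filter]
    push_cast
    exact Finset.sum_congr rfl fun i _ => by simp [hf, Set.indicator_apply]
  have hint : ∀ i < M, ∀ j < M, Integrable (fun ω => (f i ω - q) * (f j ω - q)) P ∧
      ∫ ω, (f i ω - q) * (f j ω - q) ∂P = P.real (A i ∩ A j) - q ^ 2 := by
    intro i hi j hj
    have e : (fun ω => (f i ω - q) * (f j ω - q)) = fun ω =>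
        (A i ∩ A j).indicator (1 : Ω → ℝ) ω - q * f i ω - q * f j ω + q ^ 2 := by
      funext ω
      rw [Set.inter_indicator_one]
      simp only [Pi.mul_apply, hf]
      ring
    have i1 : Integrable ((A i ∩ A j).indicator (1 : Ω → ℝ)) P :=
      (integrable_const (1 : ℝ)).indicator ((hA i hi).inter (hA j hj))
    have i2 : ∀ l < M, Integrable (fun ω => q * f l ω) P := fun l hl =>
      ((integrable_const (1 : ℝ)).indicator (hA l hl)).const_mul q
    have i3 : ∀ l < M, ∫ ω, q * f l ω ∂P = q ^ 2 := fun l hl => by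
      rw [integral_const_mul, hf, integral_indicator_one (hA l hl), hAq l hl, sq]
    rw [e]
    refine ⟨((i1.sub (i2 i hi)).sub (i2 j hj)).add (integrable_const _), ?_⟩
    change ∫ ω, (((A i ∩ A j).indicator 1 - fun ω => q * f i ω) - fun ω => q * f j ω : Ω → ℝ) ω
      + q ^ 2 ∂P = _
    rw [integral_add ((i1.sub (i2 i hi)).sub (i2 j hj)) (integrable_const _),
      integral_sub' (i1.sub (i2 i hi)) (i2 j hj), integral_sub' i1 (i2 i hi), i3 i hi, i3 j hj,
      integral_indicator_one ((hA i hi).inter (hA j hj))]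
    simp
  have hsq : ∀ ω, (∑ i ∈ Finset.range M, f i ω - M * q) ^ 2 =
      ∑ i ∈ Finset.range M, ∑ j ∈ Finset.range M, (f i ω - q) * (f j ω - q) := by
    intro ω
    rw [← Finset.sum_mul_sum, ← sq, Finset.sum_sub_distrib]
    simp
  have hi2 : ∀ i ∈ Finset.range M,
      Integrable (fun ω => ∑ j ∈ Finset.range M, (f i ω - q) * (f j ω - q)) P := fun i hi =>
    integrable_finsetSum _ fun j hj =>
      (hint i (Finset.mem_range.1 hi) j (Finset.mem_range.1 hj)).1
  have hintsq : Integrable (fun ω => (∑ i ∈ Finset.range M, f i ω - M * q) ^ 2) P := by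
    simp_rw [hsq]
    exact integrable_finsetSum _ hi2
  -- The `M` diagonal terms contribute at most `q` each, and every pair at most `c`.
  have hvar : ∫ ω, (∑ i ∈ Finset.range M, f i ω - M * q) ^ 2 ∂P ≤ M * q + M ^ 2 * c := by
    simp_rw [hsq]
    rw [integral_finsetSum _ hi2]
    have hrow : ∀ i ∈ Finset.range M,
        ∫ ω, ∑ j ∈ Finset.range M, (f i ω - q) * (f j ω - q) ∂P ≤ q + M * c := by
      intro i hi
      have hi' := Finset.mem_range.1 hi
      rw [integral_finsetSum _ fun j hj => (hint i hi' j (Finset.mem_range.1 hj)).1]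
      calc _ ≤ ∑ j ∈ Finset.range M, ((if i = j then q else 0) + c) := by
            refine Finset.sum_le_sum fun j hj => ?_
            have hj' := Finset.mem_range.1 hj
            rw [(hint i hi' j hj').2]
            split_ifs with hij
            · subst hij
              rw [Set.inter_self, hAq i hi']
              nlinarith [sq_nonneg q]
            · rcases lt_or_gt_of_ne hij with hlt | hlt
              · have := (abs_le.1 (hcov i hi' j hj' hlt)).1
                rw [hAq i hi', hAq j hj'] at this
                linarith
              · have := (abs_le.1 (hcov j hj' i hi' hlt)).1
                rw [hAq i hi', hAq j hj', Set.inter_comm] at this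
                linarith
        _ = q + M * c := by
            rw [Finset.sum_add_distrib, Finset.sum_ite_eq, if_pos hi]
            simp
    refine (Finset.sum_le_sum hrow).trans (le_of_eq ?_)
    simp
    ring
  have hcheb := mul_meas_ge_le_integral_of_nonneg (μ := P)
    (Eventually.of_forall fun ω => sq_nonneg (∑ i ∈ Finset.range M, f i ω - M * q)) hintsq
    ((M * q / 2) ^ 2)
  have hsub : {ω | (((Finset.range M).filter fun i => ω ∈ A i).card : ℝ) ≤ M * q / 2} ⊆
      {ω | (M * q / 2) ^ 2 ≤ (∑ i ∈ Finset.range M, f i ω - M * q) ^ 2} := by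
    intro ω hω
    simp only [Set.mem_ofPred_eq, hcard] at hω ⊢
    have : 0 < M * q := by positivity
    nlinarith
  have h1 := (mul_le_mul_of_nonneg_left (measureReal_mono (μ := P) hsub)
    (sq_nonneg (M * q / 2))).trans (hcheb.trans hvar)
  rw [← mul_le_mul_iff_right₀ (show (0 : ℝ) < (M * q / 2) ^ 2 by positivity)]
  refine h1.trans (le_of_eq ?_)
  field_simp
  ring

/-! ### Truncated sequences and subsampled blocks -/

section Blocks

variable {Ω E Y : Type*} [NormedAddCommGroup Y] [NormedSpace ℝ Y]
  {X : ℕ → Ω → E} {S : ℕ → (ℕ → E) → Y} {k : ℕ → ℕ}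

/-- `z` with its coordinates from `m` on replaced by `e`. -/
def truncate (e : E) (m : ℕ) (z : ℕ → E) : ℕ → E := fun i => if i < m then z i else e

/-- Uniform approximability by functions of `2n` coordinates, with the function that evaluates
`S_n` at truncated sequences as approximation. -/
theorem UniformlyApproximable.eventually_norm_lt (h : UniformlyApproximable S) (e : E) {ε : ℝ}
    (hε : 0 < ε) : ∀ᶠ n : ℕ in atTop, ∀ z : ℕ → E,
      ‖(n : ℝ)⁻¹ • S n z - (n : ℝ)⁻¹ • S n (truncate e (2 * n) z)‖ < ε := by
  obtain ⟨R, hR, hlim⟩ := h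
  have hev := (tendsto_order.1 hlim).2 (ENNReal.ofReal (ε / 2)) (by simpa using hε)
  filter_upwards [hev, eventually_ge_atTop 1] with n hn h1 z
  have hn0 : (0 : ℝ) < n := by exact_mod_cast h1
  have hb : ∀ z : ℕ → E, (n : ℝ)⁻¹ * ‖S n z - R n z‖ < ε / 2 := by
    intro z
    have hz := (le_iSup (fun z : ℕ → E => ‖S n z - R n z‖ₑ / (n : ℝ≥0∞)) z).trans_lt hn
    rw [← ofReal_norm, ← ENNReal.ofReal_natCast, ← ENNReal.ofReal_div_of_pos hn0,
      ENNReal.ofReal_lt_ofReal_iff (by positivity)] at hz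
    rwa [inv_mul_eq_div]
  have hRz : R n z = R n (truncate e (2 * n) z) :=
    hR n fun i hi => by simp [truncate, Set.mem_Iio.1 hi]
  -- `R n` is not assumed measurable, so it serves only as an intermediary: it takes the same value
  -- at `z` and at its truncation, and the error merely doubles.
  have e1 : S n z - S n (truncate e (2 * n) z) = (S n z - R n z) -
      (S n (truncate e (2 * n) z) - R n (truncate e (2 * n) z)) := by
    rw [hRz]; abel
  rw [← smul_sub, norm_smul, norm_inv, Real.norm_natCast, e1]
  calc _ ≤ (n : ℝ)⁻¹ * (‖S n z - R n z‖ +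
        ‖S n (truncate e (2 * n) z) - R n (truncate e (2 * n) z)‖) := by
        gcongr
        exact norm_sub_le _ _
    _ < ε := by
        rw [mul_add]
        linarith [hb z, hb (truncate e (2 * n) z)]

variable [MeasurableSpace Y]

theorem empirical_le_one {ω : Ω} {n : ℕ} (Γ : Set Y) : empirical k X S ω n Γ ≤ 1 := by
  rw [empirical, Measure.smul_apply, Measure.finsetSum_apply, smul_eq_mul]
  calc _ ≤ (k n : ℝ≥0∞)⁻¹ * ∑ j ∈ Finset.Icc 1 (k n), 1 := by
        gcongr
        exact prob_le_one
    _ = (k n : ℝ≥0∞)⁻¹ * k n := by simp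
    _ ≤ 1 := ENNReal.inv_mul_le_one _

open Classical in
/-- The local empirical measure counts at least the visits along a subsample of the blocks. -/
theorem card_div_le_empirical {n L M : ℕ} (hkn : 0 < k n) (hL : 0 < L)
    (hM : ∀ i < M, i * L < k n) (Γ : Set Y) (ω : Ω) :
    ENNReal.ofReal ((((Finset.range M).filter fun i =>
      (n : ℝ)⁻¹ • S n (shift (i * L * n) (path X ω)) ∈ Γ).card : ℝ) / k n) ≤
      empirical k X S ω n Γ := by
  set s := (Finset.range M).filter fun i => (n : ℝ)⁻¹ • S n (shift (i * L * n) (path X ω)) ∈ Γ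
    with hs
  -- The subsample is indexed from `0`, the empirical measure from `1`: the `i`-th kept block is
  -- block `i * L + 1`.
  have hinj : Set.InjOn (fun i => i * L + 1) (s : Set ℕ) := fun i _ j _ hij =>
    Nat.eq_of_mul_eq_mul_right hL (Nat.succ_injective hij)
  have hsub : s.image (fun i => i * L + 1) ⊆ Finset.Icc 1 (k n) := by
    intro j hj
    obtain ⟨i, hi, rfl⟩ := Finset.mem_image.1 hj
    have := hM i (Finset.mem_range.1 (Finset.mem_filter.1 hi).1)
    exact Finset.mem_Icc.2 ⟨by omega, by omega⟩
  rw [ENNReal.ofReal_div_of_pos (by exact_mod_cast hkn), ENNReal.ofReal_natCast,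
    ENNReal.ofReal_natCast, ENNReal.div_eq_inv_mul, empirical, Measure.smul_apply,
    Measure.finsetSum_apply, smul_eq_mul]
  gcongr
  calc (s.card : ℝ≥0∞) = ∑ i ∈ s, 1 := by simp
    _ ≤ ∑ i ∈ s, Measure.dirac ((n : ℝ)⁻¹ • S n (shift ((i * L + 1 - 1) * n) (path X ω))) Γ := by
        refine Finset.sum_le_sum fun i hi => ?_
        rw [Nat.add_sub_cancel, Measure.dirac_apply_of_mem (Finset.mem_filter.1 hi).2]
    _ = ∑ j ∈ s.image fun i => i * L + 1,
          Measure.dirac ((n : ℝ)⁻¹ • S n (shift ((j - 1) * n) (path X ω))) Γ :=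
        (Finset.sum_image (f := fun j =>
          Measure.dirac ((n : ℝ)⁻¹ • S n (shift ((j - 1) * n) (path X ω))) Γ) hinj).symm
    _ ≤ _ := Finset.sum_le_sum_of_subset hsub

end Blocks

/-! ### Measurability of truncated shifted paths -/

section Measurability

variable {Ω E : Type*} [MeasurableSpace E] {X : ℕ → Ω → E}

theorem measurable_truncate_shift_path {e : E} {m c : ℕ} {ℱ : MeasurableSpace Ω}
    (h : ∀ i < m, Measurable[ℱ] (X (i + c))) :
    Measurable[ℱ] fun ω => truncate e m (shift c (path X ω)) := by
  refine measurable_pi_lambda _ fun i => ?_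
  by_cases hi : i < m
  · simpa [truncate, hi, shift, path] using h i hi
  · simp [truncate, hi]

theorem measurable_sigmaPast {i j : ℕ} (h : i ≤ j) : Measurable[sigmaPast X j] (X i) :=
  Measurable.of_comap_le (le_iSup₂_of_le i h le_rfl)

theorem measurable_sigmaFuture {i j : ℕ} (h : j ≤ i) : Measurable[sigmaFuture X j] (X i) :=
  Measurable.of_comap_le (le_iSup₂_of_le i h le_rfl)

theorem measurable_truncate (e : E) (m : ℕ) : Measurable (truncate e m) := by
  refine measurable_pi_lambda _ fun i => ?_
  by_cases hi : i < m
  · simpa [truncate, hi] using measurable_pi_apply i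
  · simp [truncate, hi]

end Measurability

/-! ### Transfer of the upper bound to the local empirical measures -/

section Empirical

variable {Ω E Y : Type*} [MeasurableSpace Ω] [MeasurableSpace E]
  [NormedAddCommGroup Y] [NormedSpace ℝ Y] [MeasurableSpace Y]
  {P : Measure Ω} {X : ℕ → Ω → E} {S : ℕ → (ℕ → E) → Y} {k : ℕ → ℕ}

theorem measurable_shift (c : ℕ) : Measurable (shift c : (ℕ → E) → ℕ → E) :=
  measurable_pi_lambda _ fun i => measurable_pi_apply (i + c)

theorem IsStationary.measurable_path (hX : IsStationary P X) : Measurable (path X) :=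
  measurable_pi_lambda _ hX.measurable

theorem IsStationary.measure_shift (hX : IsStationary P X) (c : ℕ) {A : Set (ℕ → E)}
    (hA : MeasurableSet A) : P {ω | shift c (path X ω) ∈ A} = P {ω | path X ω ∈ A} := by
  have h := congrArg (fun ν => ν A) (hX.map_shift c)
  beta_reduce at h
  rwa [Measure.map_apply (f := fun ω => shift c (path X ω))
      ((measurable_shift c).comp hX.measurable_path) hA,
    Measure.map_apply hX.measurable_path hA] at h

variable [BorelSpace Y]

theorem measurable_inv_smul {n : ℕ} {f : (ℕ → E) → Y} (hf : Measurable f) :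
    Measurable fun z => (n : ℝ)⁻¹ • f z :=
  (continuous_const_smul (n : ℝ)⁻¹).measurable.comp hf

theorem law_apply (hX : IsStationary P X) (hS : ∀ n, 1 ≤ n → Measurable (S n)) {n : ℕ}
    (hn : 1 ≤ n) {A : Set Y} (hA : MeasurableSet A) :
    law P X S n A = P {ω | (n : ℝ)⁻¹ • S n (path X ω) ∈ A} :=
  Measure.map_apply ((measurable_inv_smul (hS n hn)).comp hX.measurable_path) hA

theorem measurable_empirical_apply (hX : IsStationary P X) (hS : ∀ n, 1 ≤ n → Measurable (S n))
    {n : ℕ} (hn : 1 ≤ n) {A : Set Y} (hA : MeasurableSet A) :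
    Measurable fun ω => empirical k X S ω n A := by
  simp only [empirical, Measure.smul_apply, Measure.finsetSum_apply, smul_eq_mul]
  refine (Finset.measurable_sum _ fun j _ => ?_).const_mul _
  exact (Measure.measurable_coe hA).comp (Measure.measurable_dirac.comp
    ((measurable_inv_smul (hS n hn)).comp ((measurable_shift _).comp hX.measurable_path)))

/-- By stationarity each of the `k n` Dirac masses has expectation `law P X S n A`. -/
theorem lintegral_empirical (hX : IsStationary P X) (hS : ∀ n, 1 ≤ n → Measurable (S n))
    {n : ℕ} (hn : 1 ≤ n) (hk : 0 < k n) {A : Set Y} (hA : MeasurableSet A) :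
    ∫⁻ ω, empirical k X S ω n A ∂P = law P X S n A := by
  have hT := measurable_inv_smul (n := n) (hS n hn)
  have hm : ∀ c, Measurable fun ω => (n : ℝ)⁻¹ • S n (shift c (path X ω)) := fun c =>
    hT.comp ((measurable_shift c).comp hX.measurable_path)
  have hone : ∀ c, ∫⁻ ω, Measure.dirac ((n : ℝ)⁻¹ • S n (shift c (path X ω))) A ∂P =
      law P X S n A := by
    intro c
    rw [law_apply hX hS hn hA]
    refine Eq.trans ?_ (hX.measure_shift c (hT hA))
    rw [← lintegral_indicator_one]
    · refine lintegral_congr fun ω => ?_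
      rw [Measure.dirac_apply' _ hA]
      rfl
    · exact hm c hA
  simp only [empirical, Measure.smul_apply, Measure.finsetSum_apply, smul_eq_mul]
  rw [lintegral_const_mul, lintegral_finsetSum]
  · simp only [hone, Finset.sum_const, Nat.card_Icc, Nat.add_sub_cancel, nsmul_eq_mul]
    rw [← mul_assoc, ENNReal.inv_mul_cancel (by exact_mod_cast hk.ne') (ENNReal.natCast_ne_top _),
      one_mul]
  · exact fun j _ => (Measure.measurable_coe hA).comp (Measure.measurable_dirac.comp (hm _))
  · exact Finset.measurable_sum _ fun j _ =>
      (Measure.measurable_coe hA).comp (Measure.measurable_dirac.comp (hm _))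

theorem summable_exp_neg_mul_nat {δ : ℝ} (hδ : 0 < δ) :
    Summable fun n : ℕ => Real.exp (-δ * n) := by
  simp_rw [mul_comm (-δ)]
  exact Real.summable_exp_nat_mul_iff.2 (neg_lt_zero.2 hδ)

/-- A Borel–Cantelli lemma for bounds that hold eventually. -/
theorem ae_eventually_notMem_of_eventually_le [IsFiniteMeasure P] {s : ℕ → Set Ω} {u : ℕ → ℝ}
    (hu : Summable u) (h : ∀ᶠ n in atTop, P.real (s n) ≤ u n) :
    ∀ᵐ ω ∂P, ∀ᶠ n in atTop, ω ∉ s n := by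
  refine ae_eventually_notMem ?_
  have hs : Summable fun n => P.real (s n) :=
    Summable.of_norm_bounded_eventually_nat hu (h.mono fun n hn => by
      rwa [Real.norm_of_nonneg measureReal_nonneg])
  convert hs.tsum_ofReal_ne_top using 4 with n
  exact (ofReal_measureReal).symm

/-- Markov's inequality bounds the probability that the empirical mass reaches `e^{-b'n}` by
`e^{-(b-b')n}`, which is summable. -/
theorem ae_expLE_empirical [IsProbabilityMeasure P] (hX : IsStationary P X)
    (hS : ∀ n, 1 ≤ n → Measurable (S n)) (hk : ∀ n, 1 ≤ n → 0 < k n) {A : Set Y}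
    (hA : MeasurableSet A) {b b' : ℝ} (h : ExpLE (law P X S) A b) (hb : b' < b) :
    ∀ᵐ ω ∂P, ExpLE (empirical k X S ω) A b' := by
  have key := ae_eventually_notMem_of_eventually_le (P := P)
    (s := fun n => {ω | ENNReal.ofReal (Real.exp (-b' * n)) ≤ empirical k X S ω n A})
    (summable_exp_neg_mul_nat (sub_pos.2 hb)) ?_
  · filter_upwards [key] with ω hω
    exact hω.mono fun n hn => (not_le.1 hn).le
  · filter_upwards [h, eventually_ge_atTop 1] with n hn h1
    refine ENNReal.toReal_le_of_le_ofReal (Real.exp_nonneg _) ?_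
    refine (meas_ge_le_lintegral_div (measurable_empirical_apply hX hS h1 hA).aemeasurable
      (by simpa using Real.exp_pos _) ENNReal.ofReal_ne_top).trans ?_
    rw [lintegral_empirical hX hS h1 (hk n h1) hA]
    refine (ENNReal.div_le_div_right hn _).trans (le_of_eq ?_)
    rw [← ENNReal.ofReal_div_of_pos (Real.exp_pos _), ← Real.exp_sub]
    ring_nf

end Empirical

/-! ### Transfer of the lower bound to the local empirical measures -/

section Lower

variable {Ω E Y : Type*} [MeasurableSpace Ω] [MeasurableSpace E]
  [NormedAddCommGroup Y] [NormedSpace ℝ Y] [MeasurableSpace Y] [BorelSpace Y]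
  {P : Measure Ω} [IsProbabilityMeasure P] {X : ℕ → Ω → E} {S : ℕ → (ℕ → E) → Y} {k : ℕ → ℕ}

open Classical in
/-- Second moment bound for the visits along blocks of length `2n` with starting points
`L * n` apart. -/
theorem measureReal_card_blocks_le (hX : IsStationary P X) {n : ℕ} (hn : 1 ≤ n)
    (hS : Measurable (S n)) (e : E) {B : Set Y} (hB : MeasurableSet B) {L M : ℕ} (hL : 2 ≤ L)
    (hM : 0 < M) {c q : ℝ} (hc0 : 0 ≤ c)
    (hc : alphaMixing P X (L - 1) ≤ ENNReal.ofReal c) (hq0 : 0 < q)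
    (hq : P.real {ω | (n : ℝ)⁻¹ • S n (truncate e (2 * n) (path X ω)) ∈ B} = q) :
    P.real {ω | (((Finset.range M).filter fun i =>
      (n : ℝ)⁻¹ • S n (truncate e (2 * n) (shift (i * L * n) (path X ω))) ∈ B).card : ℝ) ≤
        M * q / 2} ≤ 4 / (M * q) + 4 * c / q ^ 2 := by
  have hT : Measurable fun z => (n : ℝ)⁻¹ • S n z := measurable_inv_smul hS
  have hloc : ∀ (ℱ : MeasurableSpace Ω) (i : ℕ),
      (∀ l < 2 * n, Measurable[ℱ] (X (l + i * L * n))) → MeasurableSet[ℱ]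
        {ω | (n : ℝ)⁻¹ • S n (truncate e (2 * n) (shift (i * L * n) (path X ω))) ∈ B} :=
    fun ℱ i h => (hT.comp (measurable_truncate_shift_path h)) hB
  refine measureReal_card_le_half
    (A := fun i => {ω | (n : ℝ)⁻¹ • S n (truncate e (2 * n) (shift (i * L * n) (path X ω))) ∈ B})
    hM hq0 hc0 (fun i _ => hloc _ i fun l _ => hX.measurable _) (fun i _ => ?_)
    fun i _ j _ hij => ?_
  · rw [← hq]
    exact congrArg ENNReal.toReal
      (hX.measure_shift (i * L * n) ((hT.comp (measurable_truncate e (2 * n))) hB))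
  -- Block `i` ends at coordinate `i * L * n + 2 * n - 1`. The distance to the next kept block is at
  -- least `(L - 2) * n + 1 ≥ L - 1`.
  · have hgap : i * L * n + 2 * n - 1 + (L - 1) ≤ j * L * n := by
      obtain ⟨d, rfl⟩ := Nat.exists_eq_add_of_lt hij
      obtain ⟨l, rfl⟩ := Nat.exists_eq_add_of_le hL
      obtain ⟨m, rfl⟩ := Nat.exists_eq_add_of_le hn
      have h1 : (i + d + 1) * (2 + l) * (1 + m) =
          i * (2 + l) * (1 + m) + 2 * (1 + m) + l + (d * (2 + l) * (1 + m) + l * m) := by ring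
      omega
    exact abs_sub_le_of_alphaMixing_le (by omega) hgap
      (hloc _ i fun l hl => measurable_sigmaPast (by omega))
      (hloc _ j fun l hl => measurable_sigmaFuture (by omega)) hc0 hc

/-- Chebyshev's inequality on exponentially spaced blocks, then Borel–Cantelli. The thickening pays
for truncating `S n` once in the law and once in the empirical measure, `ε / 2` each time. -/
theorem ae_expGE_empirical (hX : IsStationary P X)
    (hS : ∀ n, 1 ≤ n → Measurable (S n)) (hk_pos : ∀ n, 1 ≤ n → 0 < k n)
    (hmix : ∀ h : ℝ, 0 < h → mixingMoment P X h < ⊤) (happ : UniformlyApproximable S)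
    {U : Set Y} (hU : IsOpen U) {ε : ℝ} (hε : 0 < ε) {a' a : ℝ} (ha' : 0 ≤ a') (ha : a' < a)
    (hlaw : ExpGE (law P X S) U a') (hk : ∀ᶠ n : ℕ in atTop, Real.exp (a * n) ≤ k n) :
    ∀ᵐ ω ∂P, ExpGE (empirical k X S ω) (Metric.thickening ε U) a := by
  classical
  obtain ⟨ω₀⟩ : Nonempty Ω := nonempty_of_isProbabilityMeasure P
  set e : E := X 0 ω₀
  -- The gap `a - a' = 2δ` is split: one `δ` pays for the spacing of blocks, the other makes `M * q`
  -- grow and absorbs constants.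
  obtain ⟨δ, hδ⟩ : ∃ δ : ℝ, δ = (a - a') / 2 := ⟨_, rfl⟩
  have hδ0 : 0 < δ := by rw [hδ]; linarith
  -- With this exponent a gap `e^{δn}` gives mixing at most `C e^{-(2a'+1)n}`, that is, `C e^{-n}`
  -- after division by `q² ≥ e^{-2a'n}`.
  obtain ⟨C, hC0, hC⟩ := exists_alphaMixing_le (P := P) (X := X)
    (h := (2 * a' + 1) / δ) (by positivity) (hmix _ (by positivity))
  set B : Set Y := Metric.thickening (ε / 2) U
  -- The `+ 1` makes the guaranteed gap `L n - 1` at least `e^{δn}`; the ceiling in `M` makes `i < M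
  -- n` equivalent to `i * L n < k n`.
  set L : ℕ → ℕ := fun n => ⌈Real.exp (δ * n)⌉₊ + 1 with hLdef
  set M : ℕ → ℕ := fun n => ⌈(k n : ℝ) / L n⌉₊
  set q : ℕ → ℝ := fun n =>
    P.real {ω | (n : ℝ)⁻¹ • S n (truncate e (2 * n) (path X ω)) ∈ B} with hqdef
  have hL2 : ∀ n, 2 ≤ L n := fun n =>
    Nat.succ_le_succ (Nat.one_le_iff_ne_zero.2 (Nat.ceil_pos.2 (Real.exp_pos _)).ne')
  have hLle : ∀ n, (L n : ℝ) ≤ 3 * Real.exp (δ * n) := fun n => by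
    have h1 := (Nat.ceil_lt_add_one (Real.exp_nonneg (δ * n))).le
    have h2 : 1 ≤ Real.exp (δ * n) := Real.one_le_exp (by positivity)
    simp only [hLdef]
    push_cast
    linarith
  have hL0 : ∀ n, (0 : ℝ) < L n := fun n => by exact_mod_cast (two_pos.trans_le (hL2 n))
  have happr := happ.eventually_norm_lt e (half_pos hε)
  have hqge : ∀ᶠ n : ℕ in atTop, Real.exp (-a' * n) ≤ q n := by
    filter_upwards [hlaw, happr, eventually_ge_atTop 1] with n hn hz h1
    rw [law_apply hX hS h1 hU.measurableSet] at hn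
    refine (ENNReal.ofReal_le_iff_le_toReal (measure_ne_top _ _)).1 (hn.trans (measure_mono ?_))
    intro ω hω
    refine Metric.mem_thickening_iff.2 ⟨_, hω, ?_⟩
    rw [dist_comm, dist_eq_norm]
    exact hz _
  have hMq : ∀ᶠ n : ℕ in atTop, Real.exp (δ * n) / 3 ≤ M n * q n := by
    filter_upwards [hqge, hk] with n hqn hkn
    have hMn : (k n : ℝ) / L n ≤ M n := Nat.le_ceil _
    have h1 : Real.exp (a * n) / (3 * Real.exp (δ * n)) ≤ M n :=
      (div_le_div₀ (Nat.cast_nonneg _) hkn (hL0 n) (hLle n)).trans hMn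
    have h2 : Real.exp (δ * n) / 3 =
        Real.exp (a * n) / (3 * Real.exp (δ * n)) * Real.exp (-a' * n) := by
      have h3 : Real.exp (a * n) * Real.exp (-a' * n) =
          Real.exp (δ * n) * Real.exp (δ * n) := by
        rw [← Real.exp_add, ← Real.exp_add, hδ]
        ring_nf
      rw [div_mul_eq_mul_div, h3]
      field_simp
    rw [h2]
    exact mul_le_mul h1 hqn (Real.exp_nonneg _) (Nat.cast_nonneg _)
  have hbad : ∀ᶠ n : ℕ in atTop, P.real {ω | (((Finset.range (M n)).filter fun i =>
      (n : ℝ)⁻¹ • S n (truncate e (2 * n) (shift (i * L n * n) (path X ω))) ∈ B).card : ℝ) ≤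
        M n * q n / 2} ≤ 12 * Real.exp (-δ * n) + 4 * C * Real.exp (-1 * n) := by
    filter_upwards [hqge, hMq, eventually_ge_atTop 1] with n hqn hMqn h1
    have hq0 : 0 < q n := (Real.exp_pos _).trans_le hqn
    have hM0 : 0 < M n := Nat.ceil_pos.2 (div_pos (by exact_mod_cast hk_pos n h1) (hL0 n))
    have hc : alphaMixing P X (L n - 1) ≤ ENNReal.ofReal (C * Real.exp (-(2 * a' + 1) * n)) := by
      refine (hC (L n - 1) (by have := hL2 n; omega)).trans (ENNReal.ofReal_le_ofReal ?_)
      refine mul_le_mul_of_nonneg_left ?_ hC0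
      have hceil : Real.exp (δ * n) ≤ ((L n - 1 : ℕ) : ℝ) := Nat.le_ceil _
      refine (Real.rpow_le_rpow_of_nonpos (Real.exp_pos _) hceil
        (neg_nonpos.2 (by positivity))).trans (le_of_eq ?_)
      rw [← Real.exp_mul]
      congr 1
      field_simp
    refine (measureReal_card_blocks_le hX h1 (hS n h1) e Metric.isOpen_thickening.measurableSet
      (hL2 n) hM0 (by positivity) hc hq0 rfl).trans (add_le_add ?_ ?_)
    · rw [div_le_iff₀ (by positivity)]
      calc (4 : ℝ) = 12 * Real.exp (-δ * n) * (Real.exp (δ * n) / 3) := by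
            have : Real.exp (-δ * n) * Real.exp (δ * n) = 1 := by
              rw [← Real.exp_add, neg_mul, neg_add_cancel, Real.exp_zero]
            linear_combination -4 * this
        _ ≤ _ := by gcongr
    · rw [div_le_iff₀ (by positivity)]
      calc 4 * (C * Real.exp (-(2 * a' + 1) * n)) =
            4 * C * Real.exp (-1 * n) * Real.exp (-a' * n) ^ 2 := by
            rw [sq, ← Real.exp_add, mul_assoc (4 * C), ← Real.exp_add, mul_assoc 4 C]
            ring_nf
        _ ≤ _ := by gcongr
  have hsum : Summable fun n : ℕ => 12 * Real.exp (-δ * n) + 4 * C * Real.exp (-1 * n) :=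
    ((summable_exp_neg_mul_nat hδ0).mul_left _).add
      ((summable_exp_neg_mul_nat one_pos).mul_left _)
  filter_upwards [ae_eventually_notMem_of_eventually_le hsum hbad] with ω hω
  -- More than `M * q / 2` successes among `k ≤ 3 M e^{δn}` blocks give mass at least `q e^{-δn} /
  -- 6`, which is at least `e^{-an}` once `e^{δn} ≥ 6`.
  filter_upwards [hω, hqge, happr, eventually_ge_atTop 1,
    (tendsto_exp_mul_nat_atTop hδ0).eventually_ge_atTop 6] with n hn hqn hz h1 h6
  have hkn : (0 : ℝ) < k n := by exact_mod_cast hk_pos n h1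
  refine le_trans (ENNReal.ofReal_le_ofReal ?_) (card_div_le_empirical (M := M n) (hk_pos n h1)
    (two_pos.trans_le (hL2 n)) (fun i hi => ?_) (Metric.thickening ε U) ω)
  · have hcard : M n * q n / 2 < (((Finset.range (M n)).filter fun i =>
        (n : ℝ)⁻¹ • S n (shift (i * L n * n) (path X ω)) ∈ Metric.thickening ε U).card : ℝ) := by
      refine (not_le.1 hn).trans_le (Nat.cast_le.2 (Finset.card_le_card ?_))
      refine Finset.monotone_filter_right _ fun i _ hi => ?_
      obtain ⟨y, hy, hdist⟩ := Metric.mem_thickening_iff.1 hi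
      refine Metric.mem_thickening_iff.2 ⟨y, hy, (dist_triangle _ _ _).trans_lt
        ((add_lt_add ?_ hdist).trans_eq (add_halves ε))⟩
      rw [dist_eq_norm]
      exact hz _
    rw [le_div_iff₀ hkn]
    refine le_trans ?_ hcard.le
    have hML : (k n : ℝ) ≤ M n * (3 * Real.exp (δ * n)) :=
      ((div_le_iff₀ (hL0 n)).1 (Nat.le_ceil _)).trans
        (mul_le_mul_of_nonneg_left (hLle n) (Nat.cast_nonneg _))
    have hexp : Real.exp (-a * n) * (Real.exp (δ * n) * Real.exp (δ * n)) =
        Real.exp (-a' * n) := by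
      rw [← Real.exp_add, ← Real.exp_add, hδ]
      ring_nf
    calc Real.exp (-a * n) * k n ≤ Real.exp (-a * n) * (M n * (3 * Real.exp (δ * n))) := by gcongr
      _ = M n * (Real.exp (-a * n) * (6 * Real.exp (δ * n))) / 2 := by ring
      _ ≤ M n * (Real.exp (-a * n) * (Real.exp (δ * n) * Real.exp (δ * n))) / 2 := by gcongr
      _ ≤ M n * q n / 2 := by rw [hexp]; gcongr
  · have h2 : (i : ℝ) < k n / L n := Nat.lt_ceil.1 hi
    rw [lt_div_iff₀ (hL0 n)] at h2
    exact_mod_cast h2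

end Lower

/-! ### The local large deviation principle -/

/-- Both growth alternatives enter the proof only through this consequence: near a point of finite
rate there are exponentially more blocks than the inverse probability of a visit. -/
theorem exists_exp_mul_le {Y : Type*} {I : Y → ℝ≥0∞} {k : ℕ → ℕ} (hk_pos : ∀ n, 1 ≤ n → 0 < k n)
    (hk :
      ((⨆ x ∈ rateDomain I, I x) < ⊤ ∧
        ((⨆ x ∈ rateDomain I, I x : ℝ≥0∞) : EReal) <
          liminf (fun n : ℕ => ((Real.log (k n) / n : ℝ) : EReal)) atTop) ∨
      Tendsto (fun n : ℕ => Real.log (k n) / n) atTop atTop)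
    {x : Y} (hx : x ∈ rateDomain I) :
    ∃ c : ℝ, 0 ≤ c ∧ I x < ENNReal.ofReal c ∧ ∀ᶠ n : ℕ in atTop, Real.exp (c * n) ≤ k n := by
  suffices H : ∃ c : ℝ, 0 ≤ c ∧ I x < ENNReal.ofReal c ∧
      ∀ᶠ n : ℕ in atTop, c ≤ Real.log (k n) / n by
    obtain ⟨c, hc0, hc, hev⟩ := H
    refine ⟨c, hc0, hc, ?_⟩
    filter_upwards [hev, eventually_ge_atTop 1] with n hn h1
    rw [le_div_iff₀ (by exact_mod_cast h1)] at hn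
    exact (Real.le_log_iff_exp_le (by exact_mod_cast hk_pos n h1)).1 hn
  rcases hk with ⟨-, hlt⟩ | hlim
  · obtain ⟨c, h1, h2⟩ := EReal.lt_iff_exists_real_btwn.1 hlt
    have hc0 : 0 ≤ c := by exact_mod_cast (EReal.coe_ennreal_nonneg _).trans h1.le
    refine ⟨c, hc0, ?_, ?_⟩
    · exact (le_iSup₂ (f := fun y (_ : y ∈ rateDomain I) => I y) x hx).trans_lt
        ((coe_ennreal_lt_coe hc0).1 h1)
    · exact (eventually_lt_of_lt_liminf h2).mono fun n hn => EReal.coe_le_coe_iff.1 hn.le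
  · refine ⟨(I x).toReal + 1, by positivity, ?_, hlim.eventually_ge_atTop _⟩
    rw [← ENNReal.ofReal_toReal (ne_of_lt hx), ENNReal.ofReal_lt_ofReal_iff (by positivity),
      ENNReal.toReal_ofReal ENNReal.toReal_nonneg]
    linarith

end LocalLDP

theorem theorem2p2
    {Ω E Y : Type*} [MeasurableSpace Ω] [MeasurableSpace E]
    [NormedAddCommGroup Y] [NormedSpace ℝ Y] [TopologicalSpace.SeparableSpace Y]
    [MeasurableSpace Y] [BorelSpace Y]
    (P : Measure Ω) [IsProbabilityMeasure P]
    (X : ℕ → Ω → E) (hX : LocalLDP.IsStationary P X)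
    (S : ℕ → (ℕ → E) → Y) (hS : ∀ n, 1 ≤ n → Measurable (S n))
    (k : ℕ → ℕ) (hk_pos : ∀ n, 1 ≤ n → 0 < k n) (hk_mono : MonotoneOn k (Set.Ici 1))
    (I : Y → ℝ≥0∞)
    (hA1 : LocalLDP.SatisfiesLDP (LocalLDP.law P X S) I)
    (hA2 : ∀ h : ℝ, 0 < h → LocalLDP.mixingMoment P X h < ⊤)
    (hA3 : LocalLDP.UniformlyApproximable S)
    (hk :
      ((⨆ x ∈ LocalLDP.rateDomain I, I x) < ⊤ ∧
        ((⨆ x ∈ LocalLDP.rateDomain I, I x : ℝ≥0∞) : EReal) <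
          liminf (fun n : ℕ => ((Real.log (k n) / n : ℝ) : EReal)) atTop) ∨
      Tendsto (fun n : ℕ => Real.log (k n) / n) atTop atTop) :
    (∀ᵐ ω ∂P, LocalLDP.SatisfiesWeakLDP (LocalLDP.empirical k X S ω) I) ∧
    (LocalLDP.ExponentiallyTight (LocalLDP.law P X S) →
      LocalLDP.IsGoodRate I ∧
        ∀ᵐ ω ∂P, LocalLDP.SatisfiesLDP (LocalLDP.empirical k X S ω) I) := by
  open LocalLDP in
  have := UniformSpace.secondCountable_of_separable Y
  set ℬ := TopologicalSpace.countableBasis Y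
  have hℬ : TopologicalSpace.IsTopologicalBasis ℬ := TopologicalSpace.isBasis_countableBasis Y
  have hℬc : ℬ.Countable := TopologicalSpace.countable_countableBasis Y
  have upper : ∀ᵐ ω ∂P, ∀ K : Set Y, IsCompact K → ∀ b : ℝ, 0 ≤ b →
      ENNReal.ofReal b < ⨅ x ∈ K, I x → ExpLE (empirical k X S ω) K b := by
    have h : ∀ᵐ ω ∂P, ∀ B ∈ ℬ, ∀ q q' : ℚ, 0 ≤ q' → q' < q →
        ENNReal.ofReal q < ⨅ x ∈ closure B, I x → ExpLE (empirical k X S ω) B q' := by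
      refine (ae_ball_iff hℬc).2 fun B hB => ae_all_iff.2 fun q => ae_all_iff.2 fun q' => ?_
      have hBm : MeasurableSet B := (hℬ.isOpen hB).measurableSet
      -- The side conditions do not involve `ω`; where they fail, the claim is vacuous.
      by_cases hq : 0 ≤ q' ∧ q' < q ∧ ENNReal.ofReal q < ⨅ x ∈ closure B, I x
      · have hlaw : ExpLE (law P X S) B q :=
          (hA1.upper B fun n _ => hBm.nullMeasurableSet).expLE
            (by exact_mod_cast hq.1.trans hq.2.1.le) hq.2.2
        filter_upwards [ae_expLE_empirical hX hS hk_pos hBm hlaw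
          (show ((q' : ℚ) : ℝ) < q by exact_mod_cast hq.2.1)] with ω hω _ _ _
        exact hω
      · exact Eventually.of_forall fun ω h1 h2 h3 => (hq ⟨h1, h2, h3⟩).elim
    filter_upwards [h] with ω hω K hK b hb0 hb
    exact expLE_of_isCompact hℬ hA1.lsc hω hK hb0 hb
  have lower : ∀ᵐ ω ∂P, ∀ Γ : Set Y, LowerBound (empirical k X S ω) I Γ := by
    have h : ∀ᵐ ω ∂P, ∀ U ∈ ℬ, ∀ ε a' a : ℚ, 0 < ε → 0 ≤ a' → a' < a →
        ExpGE (law P X S) U a' → (∀ᶠ n : ℕ in atTop, Real.exp (a * n) ≤ k n) →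
        ExpGE (empirical k X S ω) (Metric.thickening ε U) a := by
      refine (ae_ball_iff hℬc).2 fun U hU => ae_all_iff.2 fun ε => ae_all_iff.2 fun a' =>
        ae_all_iff.2 fun a => ?_
      by_cases hq : 0 < ε ∧ 0 ≤ a' ∧ a' < a ∧ ExpGE (law P X S) U a' ∧
          ∀ᶠ n : ℕ in atTop, Real.exp (a * n) ≤ k n
      · obtain ⟨h1, h2, h3, h4, h5⟩ := hq
        filter_upwards [ae_expGE_empirical hX hS hk_pos hA2 hA3 (hℬ.isOpen hU)
          (ε := ε) (a' := a') (a := a) (by exact_mod_cast h1) (by exact_mod_cast h2)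
          (by exact_mod_cast h3) h4 h5] with ω hω _ _ _ _ _
        exact hω
      · exact Eventually.of_forall fun ω h1 h2 h3 h4 h5 => (hq ⟨h1, h2, h3, h4, h5⟩).elim
    filter_upwards [h] with ω hω Γ
    refine lowerBound_of_expGE fun x hx b hb0 hb => ?_
    obtain ⟨c, hc0, hc, hkc⟩ := exists_exp_mul_le hk_pos hk (hb.trans ENNReal.ofReal_lt_top)
    have hIx : (I x).toReal < min b c := by
      rw [lt_min_iff]
      exact ⟨(ENNReal.lt_ofReal_iff_toReal_lt (hb.trans ENNReal.ofReal_lt_top).ne).1 hb,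
        (ENNReal.lt_ofReal_iff_toReal_lt (hb.trans ENNReal.ofReal_lt_top).ne).1 hc⟩
    -- Rates `I x < a' < a < min b c`: `a'` for the law near `x`, `a` for the empirical measure,
    -- below `c` so that `k n ≥ e^{an}`. Space is split likewise, `U` in the ball of radius `r / 2`
    -- and `ε < r / 2`.
    obtain ⟨a, ha1, ha2⟩ := exists_rat_btwn hIx
    obtain ⟨a', ha'1, ha'2⟩ := exists_rat_btwn ha1
    have ha'0 : (0 : ℝ) ≤ a' := ENNReal.toReal_nonneg.trans ha'1.le
    obtain ⟨r, hr0, hr⟩ := Metric.isOpen_iff.1 isOpen_interior x hx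
    obtain ⟨ε, hε0, hε⟩ := exists_rat_btwn (half_pos hr0)
    obtain ⟨U, hU, hxU, hUs⟩ := hℬ.exists_subset_of_mem_open
      (Metric.mem_ball_self (x := x) (half_pos hr0)) Metric.isOpen_ball
    have hlaw : ExpGE (law P X S) U a' := by
      refine (hA1.lower U fun n _ => (hℬ.isOpen hU).measurableSet.nullMeasurableSet).expGE
        (x := x) ?_ ha'0 ?_
      · rwa [(hℬ.isOpen hU).interior_eq]
      · exact (ENNReal.lt_ofReal_iff_toReal_lt (hb.trans ENNReal.ofReal_lt_top).ne).2 ha'1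
    refine (hω U hU ε a' a (by exact_mod_cast hε0) (by exact_mod_cast ha'0)
      (by exact_mod_cast ha'2) hlaw ?_).mono ?_ (ha2.le.trans (min_le_left _ _))
    · filter_upwards [hkc] with n hn
      refine le_trans (Real.exp_le_exp.2 ?_) hn
      exact mul_le_mul_of_nonneg_right (ha2.le.trans (min_le_right _ _)) (Nat.cast_nonneg n)
    · refine fun y hy => interior_subset (hr ?_)
      obtain ⟨z, hz, hyz⟩ := Metric.mem_thickening_iff.1 hy
      have h1 := Metric.mem_ball.1 (hUs hz)
      rw [Metric.mem_ball]
      linarith [dist_triangle y z x]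
  refine ⟨?_, fun htight => ⟨htight.isGoodRate hA1, ?_⟩⟩
  · filter_upwards [upper, lower] with ω hu hl
    refine ⟨hA1.lsc, fun Γ _ => hl Γ, fun K hK => ?_⟩
    refine upperBound_of_expLE (fun n _ => empirical_le_one K) fun b hb0 hb => ?_
    exact hu K hK b hb0 (hK.isClosed.closure_eq ▸ hb)
  · choose K hK hKlim using htight
    -- The shift by `2` leaves room for two strict losses: from the limsup to an eventual bound at
    -- rate `m + 1`, then from the law to the empirical measure.
    have htail : ∀ᵐ ω ∂P, ∀ m : ℕ, ExpLE (empirical k X S ω) (K (m + 2))ᶜ m := by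
      refine ae_all_iff.2 fun m => ?_
      refine ae_expLE_empirical hX hS hk_pos (hK _).isClosed.measurableSet.compl
        (expLE_of_limsup_lt ((hKlim _).trans_lt ?_)) (lt_add_one (m : ℝ))
      rw [EReal.coe_lt_coe_iff]
      linarith
    filter_upwards [upper, lower, htail] with ω hu hl ht
    refine ⟨hA1.lsc, fun Γ _ => hl Γ, fun Γ _ => ?_⟩
    refine upperBound_of_expLE (fun n _ => empirical_le_one Γ) fun b hb0 hb => ?_
    obtain ⟨c, hbc, hc⟩ := ENNReal.lt_iff_exists_nnreal_btwn.1 hb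
    rw [ENNReal.ofReal_lt_coe_iff hb0] at hbc
    obtain ⟨m, hm⟩ := exists_nat_gt (c : ℝ)
    -- `Γ` is covered by a compact piece, where the weak upper bound applies, and a tail of rate `m
    -- > c`.
    have h1 : ExpLE (empirical k X S ω) (closure Γ ∩ K (m + 2)) c :=
      hu _ ((hK _).inter_left isClosed_closure) c c.2 (by
        rw [ENNReal.ofReal_coe_nnreal]
        exact hc.trans_le (biInf_mono fun x hx => hx.1))
    refine (h1.union ((ht m).mono subset_rfl hm.le) hbc).mono (fun x hx => ?_) le_rfl
    by_cases hxK : x ∈ K (m + 2)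
    · exact Or.inl ⟨subset_closure hx, hxK⟩
    · exact Or.inr hxK
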